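/- **Setting.** Let $(\Omega,\mathcal F,P)$ be a nonatomic, complete probability space and $\Xi$ a complete separable metric space with a $\sigma$-algebra containing the Borel sets. Let $\xi,\xi^1,\xi^2,\dots:\Omega\to\Xi$ be measurable, where $\xi^1,\xi^2,\dots$ are independent and each has the same law as $\xi$. Assume: 1. $Z$ is a separable reflexive real Banach space, $Z_{\rm ad}\subset Z$ is nonempty, closed, convex and bounded, $Y$ is a real Banach space, and $Y_0\subset Y$ is closed. 2. $\mathbf B:Z\to Y$ is linear and completely continuous (i.e. $z_k\rightharpoonup z$ implies $\mathbf Bz_k\to\mathbf Bz$ in norm), and $\mathbf B(Z_{\rm ad})\subset Y_0$. 3. $\wp:Z\to[0,\infty)$ is convex and continuous. 4. $f:Y_0\times\Xi\to\mathbb R$ is a Carathéodory function: $f(y,\cdot)$ is measurable for every $y\in Y_0$ and $f(\cdot,x)$ is continuous for every $x\in\Xi$. 5. For all $y\in Y_0$, $F(y):=f(y,\xi(\cdot))\in L^2(\Omega,\mathcal F,P)$, and $F:Y_0\to L^2(\Omega,\mathcal F,P)$ is continuous. 6. For each $\bar y\in Y_0$ there are a neighborhood $\mathcal Y_{\bar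 y}$ of $\bar y$ and a random variable $h\in L^2(\Omega,\mathcal F,P)$ such that, for every $y\in \mathcal Y_{\bar y}\cap Y_0$, $f(y,\xi(\cdot))\ge h(\cdot)$ almost surely. For $\beta\in[0,1)$, $\varepsilon>0$ and $X\in L^2(\Omega,\mathcal F,P)$ let $$\mathrm{AVaR}_\beta[X]=\inf_{t\in\mathbb R}\Big\{t+\tfrac1{1-\beta}\mathbb E[\max\{0,X-t\}]\Big\},\qquad \Phi[X]=\tfrac12\mathbb E[X^2]+\mathbb E[X],$$ $$\mathrm{AVaR}_\beta^{\varepsilon}[X]=\inf_{W\in L^2(\Omega,\mathcal F,P)}\big\{\mathrm{AVaR}_\beta[X-W]+\varepsilon\,\Phi[\varepsilon^{-1}W]\big\}.$$ These functionals are law invariant. For a distribution function $H$ of some element of $L^2(\Omega,\mathcal F,P)$, write $\mathrm{AVaR}_\beta^{\varepsilon}[H]$ for the value at any $X\in L^2(\Omega,\mathcal F,P)$ with distribution function $H$. For $y\in Y_0$ and $\omega\in\Omega$ let $\hat H_{y,N,\omega}$ be the empirical distribution function of $f(y,\xi^1(\omega)),\dots,f(y,\xi^N(\omega))$. Let $m^*$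 and $\mathscr S$ be the optimal value and the solution set of $$\min_{z\in Z_{\rm ad}}\ \mathrm{AVaR}_\beta[F(\mathbf Bz)]+\wp(z),$$ and let $\hat m^{\varepsilon}_{\mathrm{epi},N}$ and $\hat{\mathscr S}^{\varepsilon}_{\mathrm{epi},N}$ (depending on $\omega$) be those of $$\min_{z\in Z_{\rm ad}}\ \mathrm{AVaR}_\beta^{\varepsilon}[\hat H_{\mathbf Bz,N,\omega}]+\wp(z).$$ For $\Gamma,\Psi\subset Z$ let $\mathbb D(\Gamma,\Psi)=\sup_{x\in\Gamma}\inf_{y\in\Psi}\|x-y\|_Z$. A function $\varphi:Z\to[0,\infty)$ is an *R-function* if it is convex and continuous and if $v_k\rightharpoonup v$ together with $\varphi(v_k)\to\varphi(v)$ implies $v_k\to v$ in norm. **Proposition.** Let $\beta\in[0,1)$ and let $(\varepsilon_N)\subset(0,\infty)$ satisfy $\varepsilon_N\to0$. Then, almost surely, $\hat m^{\varepsilon_N}_{\mathrm{epi},N}\to m^*$ as $N\to\infty$. If furthermore $\wp$ is an R-function, then, almost surely, $\mathbb D\big(\hat{\mathscr S}^{\varepsilon_N}_{\mathrm{epi},N},\mathscr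 S\big)\to0$ as $N\to\infty$. -/

import Mathlib

open MeasureTheory ProbabilityTheory Filter Topology
open scoped ENNReal

noncomputable section

namespace EpiAVaR

section Spaces

variable {V W : Type*} [NormedAddCommGroup V] [NormedSpace ℝ V]
  [NormedAddCommGroup W] [NormedSpace ℝ W]

/-- A real normed space is reflexive if the canonical embedding into its bidual is onto. -/
def IsReflexive (V : Type*) [NormedAddCommGroup V] [NormedSpace ℝ V] : Prop :=
  Function.Surjective (NormedSpace.inclusionInDoubleDual ℝ V)

/-- Weak convergence `v k ⇀ w` of a sequence. -/
def WeakTendsto (v : ℕ → V) (w : V) : Prop :=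
  ∀ φ : StrongDual ℝ V, Tendsto (fun k => φ (v k)) atTop (𝓝 (φ w))

/-- A mapping is completely continuous if it maps weakly convergent sequences to norm convergent
ones (with the corresponding limit). -/
def CompletelyContinuous (G : V → W) : Prop :=
  ∀ (v : ℕ → V) (w : V), WeakTendsto v w → Tendsto (fun k => G (v k)) atTop (𝓝 (G w))

/-- R-functions: nonnegative, convex, continuous, and such that weak convergence together with
convergence of the function values implies norm convergence. -/
structure IsRFunction (φ : V → ℝ) : Prop where
  nonneg : ∀ v, 0 ≤ φ v
  convex : ConvexOn ℝ Set.univ φ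
  continuous : Continuous φ
  strong : ∀ (v : ℕ → V) (w : V), WeakTendsto v w →
    Tendsto (fun k => φ (v k)) atTop (𝓝 (φ w)) → Tendsto v atTop (𝓝 w)

/-- The deviation `sup_{x ∈ Γ} dist (x, Ψ)`, as an extended nonnegative real. -/
def deviation (Γ Ψ : Set V) : ℝ≥0∞ := ⨆ x ∈ Γ, Metric.infEDist x Ψ

/-- The optimal value of `min_{z ∈ S} J z`, as an extended real number. -/
def optValue (S : Set V) (J : V → ℝ) : EReal := ⨅ z ∈ S, (J z : EReal)

/-- The solution set of `min_{z ∈ S} J z`. -/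
def solutionSet (S : Set V) (J : V → ℝ) : Set V := {z ∈ S | (J z : EReal) = optValue S J}

end Spaces

section Risk

variable {Ω : Type*} [MeasurableSpace Ω]

/-- A measure is nonatomic if every measurable set of positive measure has a measurable subset of
positive, strictly smaller measure. -/
def Nonatomic (P : Measure Ω) : Prop :=
  ∀ A, MeasurableSet A → 0 < P A → ∃ B ⊆ A, MeasurableSet B ∧ 0 < P B ∧ P B < P A

open Classical in
/-- The element of `L²(Ω, F, P)` given by a square integrable function (and `0` for any other
function). -/
def toL2 (P : Measure Ω) (X : Ω → ℝ) : Lp ℝ 2 P :=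
  if h : MemLp X 2 P then h.toLp X else 0

/-- Law invariance: the value depends on a random variable only through its distribution
function. -/
def LawInvariant {P : Measure Ω} (ρ : Lp ℝ 2 P → ℝ) : Prop :=
  ∀ X₁ X₂ : Lp ℝ 2 P, (∀ t : ℝ, P.real {ω | X₁ ω ≤ t} = P.real {ω | X₂ ω ≤ t}) → ρ X₁ = ρ X₂

open Classical in
/-- The value `ρ[H]` of a law invariant functional `ρ` at a distribution function `H`, that is,
the value of `ρ` at any random variable in `L²(Ω, F, P)` with distribution function `H`
(and `0` if there is none). -/
def atDistribution {P : Measure Ω} (ρ : Lp ℝ 2 P → ℝ) (H : ℝ → ℝ) : ℝ :=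
  if h : ∃ X : Lp ℝ 2 P, ∀ t : ℝ, P.real {ω | X ω ≤ t} = H t then ρ h.choose else 0

/-- The value at a distribution function does not depend on the random variable representing it. -/
theorem atDistribution_eq {P : Measure Ω} {ρ : Lp ℝ 2 P → ℝ} (hρ : LawInvariant ρ) {H : ℝ → ℝ}
    (X : Lp ℝ 2 P) (hX : ∀ t : ℝ, P.real {ω | X ω ≤ t} = H t) : atDistribution ρ H = ρ X := by
  have h : ∃ X : Lp ℝ 2 P, ∀ t : ℝ, P.real {ω | X ω ≤ t} = H t := ⟨X, hX⟩
  rw [atDistribution, dif_pos h]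
  exact hρ _ _ fun t => (h.choose_spec t).trans (hX t).symm

/-- The empirical distribution function `t ↦ (1/N) #{i < N | x i ≤ t}` of the sample
`x 0, …, x (N - 1)`. -/
def empiricalCDF (x : ℕ → ℝ) (N : ℕ) (t : ℝ) : ℝ :=
  (N : ℝ)⁻¹ * ∑ i ∈ Finset.range N, (Set.Iic t).indicator (fun _ => (1 : ℝ)) (x i)

/-- The average value-at-risk `inf_t { t + (1 - β)⁻¹ E[max(0, X - t)] }`. -/
def avar {P : Measure Ω} (β : ℝ) (X : Lp ℝ 2 P) : ℝ :=
  ⨅ t : ℝ, (t + 1 / (1 - β) * ∫ ω, max 0 (X ω - t) ∂P)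

/-- The regularizer `Φ[X] = (1/2) E[X²] + E[X]`. -/
def regPhi {P : Measure Ω} (X : Lp ℝ 2 P) : ℝ :=
  1 / 2 * ∫ ω, (X ω) ^ 2 ∂P + ∫ ω, X ω ∂P

/-- The epi-regularization `inf_Y { AVaR(X - Y) + ε Φ[ε⁻¹ Y] }` of the average value-at-risk. -/
def epiAvar {P : Measure Ω} (β ε : ℝ) (X : Lp ℝ 2 P) : ℝ :=
  ⨅ Y : Lp ℝ 2 P, (avar β (X - Y) + ε * regPhi (ε⁻¹ • Y))

end Risk

section WellDefined

/-! The infima defining `avar` and `epiAvar` are over sets that are bounded below, and both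
functionals are law invariant, so that their values at distribution functions make sense. -/

variable {Ω : Type*} [MeasurableSpace Ω] {P : Measure Ω} [IsProbabilityMeasure P]

theorem integrable_l2 (X : Lp ℝ 2 P) : Integrable (fun ω => X ω) P :=
  (Lp.memLp X).integrable (by norm_num)

theorem integrable_plus (X : Lp ℝ 2 P) (t : ℝ) :
    Integrable (fun ω => max 0 (X ω - t)) P :=
  (integrable_zero Ω ℝ P).sup ((integrable_l2 X).sub (integrable_const t))

theorem integral_le_avar_term {β : ℝ} (hβ0 : 0 ≤ β) (hβ1 : β < 1) (X : Lp ℝ 2 P) (t : ℝ) :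
    ∫ ω, X ω ∂P ≤ t + 1 / (1 - β) * ∫ ω, max 0 (X ω - t) ∂P := by
  have h1 : (1 : ℝ) ≤ 1 / (1 - β) := by
    rw [le_div_iff₀ (by linarith)]; linarith
  have h0 : 0 ≤ ∫ ω, max 0 (X ω - t) ∂P := integral_nonneg fun ω => le_max_left _ _
  have h2 : ∫ ω, (X ω - t) ∂P ≤ ∫ ω, max 0 (X ω - t) ∂P :=
    integral_mono ((integrable_l2 X).sub (integrable_const t)) (integrable_plus X t)
      fun ω => le_max_right _ _
  rw [integral_sub (integrable_l2 X) (integrable_const t)] at h2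
  simp only [integral_const, probReal_univ, smul_eq_mul, one_mul] at h2
  nlinarith

theorem avar_bddBelow {β : ℝ} (hβ0 : 0 ≤ β) (hβ1 : β < 1) (X : Lp ℝ 2 P) :
    BddBelow (Set.range fun t : ℝ => t + 1 / (1 - β) * ∫ ω, max 0 (X ω - t) ∂P) :=
  ⟨∫ ω, X ω ∂P, by rintro _ ⟨t, rfl⟩; exact integral_le_avar_term hβ0 hβ1 X t⟩

theorem reg_eq {ε : ℝ} (hε : 0 < ε) (Y : Lp ℝ 2 P) :
    ε * regPhi (ε⁻¹ • Y) = ∫ ω, ((Y ω) ^ 2 / (2 * ε) + Y ω) ∂P := by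
  have h : ⇑(ε⁻¹ • Y) =ᵐ[P] fun ω => ε⁻¹ * Y ω := by
    filter_upwards [Lp.coeFn_smul ε⁻¹ Y] with ω hω
    simpa using hω
  have hi : Integrable (fun ω => (Y ω) ^ 2) P := (Lp.memLp Y).integrable_sq
  have h2 : (fun ω => ((ε⁻¹ • Y : Lp ℝ 2 P) ω) ^ 2) =ᵐ[P] fun ω => (ε⁻¹ * Y ω) ^ 2 := by
    filter_upwards [h] with ω hω
    rw [hω]
  rw [regPhi, integral_congr_ae h2, integral_congr_ae h,
    integral_add (hi.div_const _) (integrable_l2 Y), integral_div]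
  simp only [mul_pow, integral_const_mul]
  field_simp

theorem epiAvar_bddBelow {β ε : ℝ} (hβ0 : 0 ≤ β) (hβ1 : β < 1) (hε : 0 < ε) (X : Lp ℝ 2 P) :
    BddBelow (Set.range fun Y : Lp ℝ 2 P => avar β (X - Y) + ε * regPhi (ε⁻¹ • Y)) := by
  refine ⟨∫ ω, X ω ∂P, ?_⟩
  rintro _ ⟨Y, rfl⟩
  have h1 : ∫ ω, (X - Y) ω ∂P ≤ avar β (X - Y) :=
    le_ciInf fun t => integral_le_avar_term hβ0 hβ1 (X - Y) t
  have h2 : ∫ ω, Y ω ∂P ≤ ε * regPhi (ε⁻¹ • Y) := by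
    rw [reg_eq hε]
    refine integral_mono (integrable_l2 Y)
      (((Lp.memLp Y).integrable_sq.div_const _).add (integrable_l2 Y)) fun ω => ?_
    have : 0 ≤ (Y ω) ^ 2 / (2 * ε) := by positivity
    simpa using this
  rw [integral_congr_ae (Lp.coeFn_sub X Y)] at h1
  simp only [Pi.sub_apply] at h1
  rw [integral_sub (integrable_l2 X) (integrable_l2 Y)] at h1
  show _ ≤ avar β (X - Y) + ε * regPhi (ε⁻¹ • Y)
  linarith

theorem integral_comp_eq {X₁ X₂ : Lp ℝ 2 P}
    (h : ∀ t : ℝ, P.real {ω | X₁ ω ≤ t} = P.real {ω | X₂ ω ≤ t}) {v : ℝ → ℝ}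
    (hv : Measurable v) : ∫ ω, v (X₁ ω) ∂P = ∫ ω, v (X₂ ω) ∂P := by
  have m₁ : Measurable ⇑X₁ := (Lp.stronglyMeasurable X₁).measurable
  have m₂ : Measurable ⇑X₂ := (Lp.stronglyMeasurable X₂).measurable
  have key : P.map X₁ = P.map X₂ := by
    have := Measure.isProbabilityMeasure_map (μ := P) m₁.aemeasurable
    refine Measure.ext_of_Iic _ _ fun t => ?_
    rw [Measure.map_apply m₁ measurableSet_Iic, Measure.map_apply m₂ measurableSet_Iic]
    exact (measureReal_eq_measureReal_iff).1 (h t)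
  rw [← integral_map m₁.aemeasurable hv.aestronglyMeasurable, key,
    integral_map m₂.aemeasurable hv.aestronglyMeasurable]

theorem avar_lawInvariant (β : ℝ) : LawInvariant (avar (P := P) β) := by
  intro X₁ X₂ h
  unfold avar
  congr 1
  funext t
  rw [integral_comp_eq h (v := fun x => max 0 (x - t)) (by fun_prop)]

/-- The pointwise minimizer of `y ↦ (1 - β)⁻¹ max(0, x - y) + y² / (2ε) + y`. -/
def clampReg (β ε x : ℝ) : ℝ := max (-ε) (min x (ε * (1 / (1 - β) - 1)))

theorem clampReg_min {β ε : ℝ} (hβ0 : 0 ≤ β) (hβ1 : β < 1) (hε : 0 < ε) (x y : ℝ) :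
    1 / (1 - β) * max 0 (x - clampReg β ε x) + ((clampReg β ε x) ^ 2 / (2 * ε) + clampReg β ε x) ≤
      1 / (1 - β) * max 0 (x - y) + (y ^ 2 / (2 * ε) + y) := by
  have hc : (1 : ℝ) ≤ 1 / (1 - β) := by
    rw [le_div_iff₀ (by linarith)]; linarith
  unfold clampReg
  generalize 1 / (1 - β) = c at *
  have hd : ∀ k : ℝ, y ^ 2 / (2 * ε) - k ^ 2 / (2 * ε) = (y - k) ^ 2 / (2 * ε) + k / ε * (y - k) := by
    intro k; field_simp; ring
  have hs : ∀ k : ℝ, 0 ≤ (y - k) ^ 2 / (2 * ε) := fun k => by positivity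
  have hb : -ε ≤ ε * (c - 1) := by nlinarith
  have hm1 : 0 ≤ max 0 (x - y) := le_max_left _ _
  have hm2 : x - y ≤ max 0 (x - y) := le_max_right _ _
  rcases le_total x (ε * (c - 1)) with h1 | h1
  · rw [min_eq_left h1]
    rcases le_total (-ε) x with h2 | h2
    · rw [max_eq_right h2]
      have e1 := hd x
      have e2 := hs x
      have e3 : -1 ≤ x / ε := by rw [le_div_iff₀ hε]; linarith
      have e4 : x / ε ≤ c - 1 := by rw [div_le_iff₀ hε]; linarith
      rw [sub_self, max_self]
      rcases le_total x y with h3 | h3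
      · nlinarith [mul_nonneg (sub_nonneg.2 h3) (by linarith : 0 ≤ x / ε + 1)]
      · nlinarith [mul_nonneg (sub_nonneg.2 h3) (by linarith : 0 ≤ c - 1 - x / ε)]
    · rw [max_eq_left h2, max_eq_left (by linarith : x - -ε ≤ 0)]
      have e1 := hd (-ε)
      have e2 := hs (-ε)
      rw [neg_div, div_self hε.ne'] at e1
      nlinarith
  · rw [min_eq_right h1, max_eq_right hb, max_eq_right (by linarith : 0 ≤ x - ε * (c - 1))]
    have e1 := hd (ε * (c - 1))
    have e2 := hs (ε * (c - 1))
    rw [mul_div_cancel_left₀ _ hε.ne'] at e1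
    nlinarith

theorem epiAvar_le_of_law {β ε : ℝ} (hβ0 : 0 ≤ β) (hβ1 : β < 1) (hε : 0 < ε) {X₁ X₂ : Lp ℝ 2 P}
    (h : ∀ t : ℝ, P.real {ω | X₁ ω ≤ t} = P.real {ω | X₂ ω ≤ t}) :
    epiAvar β ε X₁ ≤ epiAvar β ε X₂ := by
  refine le_ciInf fun Y => ?_
  rw [← sub_le_iff_le_add]
  refine le_ciInf fun t => ?_
  rw [sub_le_iff_le_add, reg_eq hε]
  have hmk : Measurable (clampReg β ε) := by unfold clampReg; fun_prop
  have hbd : ∀ x, ‖clampReg β ε x‖ ≤ ε + |ε * (1 / (1 - β) - 1)| := by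
    intro x
    unfold clampReg
    rw [Real.norm_eq_abs, abs_le]
    have a0 := le_abs_self (ε * (1 / (1 - β) - 1))
    have a1 := abs_nonneg (ε * (1 / (1 - β) - 1))
    refine ⟨le_trans (by linarith) (le_max_left _ _), max_le (by linarith) ?_⟩
    exact (min_le_right _ _).trans (by linarith)
  have mX : ∀ X : Lp ℝ 2 P, Measurable ⇑X := fun X => (Lp.stronglyMeasurable X).measurable
  have hmem : ∀ X : Lp ℝ 2 P, MemLp (fun ω => clampReg β ε (X ω - t)) 2 P := fun X =>
    MemLp.of_bound (hmk.comp ((mX X).sub_const t)).aestronglyMeasurable _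
      (Eventually.of_forall fun ω => hbd _)
  set Y₁ : Lp ℝ 2 P := (hmem X₁).toLp _ with hY₁
  have hY₁e : ⇑Y₁ =ᵐ[P] fun ω => clampReg β ε (X₁ ω - t) := (hmem X₁).coeFn_toLp
  have g1 : epiAvar β ε X₁ ≤ avar β (X₁ - Y₁) + ε * regPhi (ε⁻¹ • Y₁) :=
    ciInf_le (epiAvar_bddBelow hβ0 hβ1 hε X₁) Y₁
  have g2 : avar β (X₁ - Y₁) ≤ t + 1 / (1 - β) * ∫ ω, max 0 ((X₁ - Y₁) ω - t) ∂P :=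
    ciInf_le (avar_bddBelow hβ0 hβ1 (X₁ - Y₁)) t
  have comb : ∀ X Y : Lp ℝ 2 P, Integrable (fun ω => 1 / (1 - β) * max 0 (X ω - t - Y ω) +
        ((Y ω) ^ 2 / (2 * ε) + Y ω)) P ∧
      1 / (1 - β) * ∫ ω, max 0 ((X - Y) ω - t) ∂P + ∫ ω, ((Y ω) ^ 2 / (2 * ε) + Y ω) ∂P =
      ∫ ω, (1 / (1 - β) * max 0 (X ω - t - Y ω) + ((Y ω) ^ 2 / (2 * ε) + Y ω)) ∂P := by
    intro X Y
    have e : (fun ω => max 0 ((X - Y) ω - t)) =ᵐ[P] fun ω => max 0 (X ω - t - Y ω) := by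
      filter_upwards [Lp.coeFn_sub X Y] with ω hω
      rw [hω, Pi.sub_apply, sub_right_comm]
    have i1 : Integrable (fun ω => max 0 (X ω - t - Y ω)) P := (integrable_plus (X - Y) t).congr e
    have i2 : Integrable (fun ω => (Y ω) ^ 2 / (2 * ε) + Y ω) P :=
      ((Lp.memLp Y).integrable_sq.div_const _).add (integrable_l2 Y)
    refine ⟨(i1.const_mul _).add i2, ?_⟩
    rw [integral_congr_ae e, integral_add (i1.const_mul _) i2, integral_const_mul]
  rw [reg_eq hε] at g1
  obtain ⟨i1, c1⟩ := comb X₁ Y₁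
  obtain ⟨i2, c2⟩ := comb X₂ Y
  set v : ℝ → ℝ := fun x => 1 / (1 - β) * max 0 (x - t - clampReg β ε (x - t)) +
    ((clampReg β ε (x - t)) ^ 2 / (2 * ε) + clampReg β ε (x - t)) with hv
  have hvm : Measurable v := by
    have : Measurable fun x : ℝ => clampReg β ε (x - t) := hmk.comp (measurable_id.sub_const t)
    fun_prop
  have e1 : (fun ω => 1 / (1 - β) * max 0 (X₁ ω - t - Y₁ ω) + ((Y₁ ω) ^ 2 / (2 * ε) + Y₁ ω))
      =ᵐ[P] fun ω => v (X₁ ω) := by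
    filter_upwards [hY₁e] with ω hω
    rw [hω]
  have iv : Integrable (fun ω => v (X₂ ω)) P := by
    obtain ⟨i3, -⟩ := comb X₂ ((hmem X₂).toLp _)
    refine i3.congr ?_
    filter_upwards [(hmem X₂).coeFn_toLp] with ω hω
    rw [hω]
  have e2 : ∫ ω, v (X₂ ω) ∂P ≤
      ∫ ω, (1 / (1 - β) * max 0 (X₂ ω - t - Y ω) + ((Y ω) ^ 2 / (2 * ε) + Y ω)) ∂P :=
    integral_mono iv i2 fun ω => clampReg_min hβ0 hβ1 hε _ _
  rw [integral_congr_ae e1, integral_comp_eq h hvm] at c1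
  linarith

theorem epiAvar_lawInvariant {β ε : ℝ} (hβ0 : 0 ≤ β) (hβ1 : β < 1) (hε : 0 < ε) :
    LawInvariant (epiAvar (P := P) β ε) := fun _ _ h =>
  le_antisymm (epiAvar_le_of_law hβ0 hβ1 hε h) (epiAvar_le_of_law hβ0 hβ1 hε fun t => (h t).symm)

end WellDefined

end EpiAVaR

end

/-! Put c = 1/(1-β) and view AVaR as `infTail`, the infimum over t of t + c q(t) with q the tail
expectation. Three facts carry the argument.

Regularization: AVaR[X] - (1+c)²ε/2 ≤ AVaR^ε[X] ≤ AVaR[X] for every X. On a nonatomic space each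
empirical distribution is the law of some X, so dropping the regularization costs an error that is
uniform in the sample and in z (`abs_atDistribution_epiAvar_sub_le`).

Sampling: `infTail` is c-Lipschitz in q for the sup norm, so a strong law in the Banach space of
bounded continuous functions of t gives almost sure convergence for a single integrand
(`ae_tendsto_infTail_empTail`). Uniformity in y is needed only from below. Near y₀ the integrand is
replaced by its infimum over a small neighbourhood; AVaR is monotone, and dominated convergence
makes the loss small. The image of the feasible set is compact, so finitely many neighbourhoods
suffice (`ae_eventually_infTail_le`).

Optimization: a uniform lower bound plus convergence at one true minimizer gives convergence of the
values (`tendsto_optValue`). Empirical solutions then form a minimizing sequence of the true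
problem. Along a weakly convergent subsequence the risk term converges, hence so does the
regularizer, and the R-property turns weak into norm convergence (`tendsto_deviation`). -/

noncomputable section

namespace EpiAVaR

/-! ### Weak sequential compactness and weak lower semicontinuity. -/

section WeakCompactness

variable {Z : Type*} [NormedAddCommGroup Z] [NormedSpace ℝ Z]

/-- In a separable normed space, countably many continuous functionals separate the points. -/
theorem exists_seq_dual_separating [TopologicalSpace.SeparableSpace Z] :
    ∃ φ : ℕ → StrongDual ℝ Z, ∀ v, (∀ n, φ n v = 0) → v = 0 := by
  choose φ hφ1 hφ2 using fun n => exists_dual_vector'' ℝ (TopologicalSpace.denseSeq Z n)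
  refine ⟨φ, fun v hv => ?_⟩
  by_contra hne
  have hpos : 0 < ‖v‖ / 2 := by positivity
  obtain ⟨_, hd, n, rfl⟩ := Metric.dense_iff.1 (TopologicalSpace.denseRange_denseSeq Z) v _ hpos
  rw [Metric.mem_ball, dist_eq_norm] at hd
  set d := TopologicalSpace.denseSeq Z n
  -- The functional `φ n` norms `d` and kills `v`, so `‖d‖ = φ n (d - v)`; a nonzero `v` could not
  -- be that close to `d`.
  have h1 : ‖d‖ ≤ ‖d - v‖ := by
    have h2 := (φ n).le_of_opNorm_le (hφ1 n) (d - v)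
    rw [map_sub, hv n, sub_zero, one_mul] at h2
    rw [show φ n d = ‖d‖ from hφ2 n] at h2
    simpa using h2
  have h3 : ‖v‖ ≤ ‖d‖ + ‖d - v‖ := by
    calc ‖v‖ = ‖d - (d - v)‖ := by congr 1; abel
      _ ≤ _ := norm_sub_le _ _
  linarith

/-- Bounded sequences in separable reflexive spaces have weakly convergent subsequences. -/
theorem exists_weakTendsto_subseq [TopologicalSpace.SeparableSpace Z] (hZ : IsReflexive Z)
    {v : ℕ → Z} (hv : Bornology.IsBounded (Set.range v)) :
    ∃ (w : Z) (k : ℕ → ℕ), StrictMono k ∧ WeakTendsto (v ∘ k) w := by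
  obtain ⟨R, hR⟩ := hv.exists_norm_le
  let K : Set (WeakDual ℝ (StrongDual ℝ Z)) := WeakDual.toStrongDual ⁻¹' Metric.closedBall 0 R
  have hK : IsCompact K := WeakDual.isCompact_closedBall (0 : StrongDual ℝ (StrongDual ℝ Z)) R
  have : CompactSpace K := isCompact_iff_compactSpace.mp hK
  obtain ⟨φ, hφ⟩ := exists_seq_dual_separating (Z := Z)
  -- Banach–Alaoglu gives compactness only. By reflexivity the points of `K` are evaluations at
  -- vectors, so the countable family `φ` separates them; this makes `K` metrizable, hence
  -- sequentially compact.
  have : TopologicalSpace.MetrizableSpace K := by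
    refine Metric.PiNatEmbed.TopologicalSpace.MetrizableSpace.of_countable_separating
      (fun n (k : K) => (k : WeakDual ℝ (StrongDual ℝ Z)) (φ n))
      (fun n => (WeakDual.eval_continuous (φ n)).comp continuous_subtype_val) fun x y hxy => ?_
    by_contra! hc
    refine hxy (Subtype.ext ?_)
    obtain ⟨a, ha⟩ := hZ (WeakDual.toStrongDual (x : WeakDual ℝ (StrongDual ℝ Z)))
    obtain ⟨b, hb⟩ := hZ (WeakDual.toStrongDual (y : WeakDual ℝ (StrongDual ℝ Z)))
    have ha' : ∀ ψ : StrongDual ℝ Z, (x : WeakDual ℝ (StrongDual ℝ Z)) ψ = ψ a := fun ψ =>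
      (DFunLike.congr_fun ha ψ).symm
    have hb' : ∀ ψ : StrongDual ℝ Z, (y : WeakDual ℝ (StrongDual ℝ Z)) ψ = ψ b := fun ψ =>
      (DFunLike.congr_fun hb ψ).symm
    have hab : a - b = 0 := hφ _ fun n => by
      have := hc n
      rw [ha', hb'] at this
      rw [map_sub, this, sub_self]
    refine DFunLike.ext _ _ fun ψ => ?_
    rw [ha', hb', sub_eq_zero.1 hab]
  have hmem : ∀ n, StrongDual.toWeakDual (NormedSpace.inclusionInDoubleDual ℝ Z (v n)) ∈ K := by
    intro n
    have h1 : NormedSpace.inclusionInDoubleDual ℝ Z (v n) ∈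
        Metric.closedBall (0 : StrongDual ℝ (StrongDual ℝ Z)) R := by
      refine (dist_zero_right (E := StrongDual ℝ (StrongDual ℝ Z)) _).trans_le ?_
      exact (NormedSpace.double_dual_bound ℝ Z (v n)).trans (hR _ ⟨n, rfl⟩)
    exact h1
  obtain ⟨x, k, hk, hx⟩ := CompactSpace.tendsto_subseq fun n => (⟨_, hmem n⟩ : K)
  obtain ⟨a, ha⟩ := hZ (WeakDual.toStrongDual (x : WeakDual ℝ (StrongDual ℝ Z)))
  refine ⟨a, k, hk, fun ψ => ?_⟩
  have h2 := (((WeakDual.eval_continuous ψ).comp continuous_subtype_val).tendsto x).comp hx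
  have h3 : (x : WeakDual ℝ (StrongDual ℝ Z)) ψ = ψ a := (DFunLike.congr_fun ha ψ).symm
  simp only [Function.comp_def] at h2
  rw [h3] at h2
  exact h2

/-- Closed convex sets are weakly sequentially closed. -/
theorem WeakTendsto.mem_of_frequently {v : ℕ → Z} {w : Z} (h : WeakTendsto v w) {S : Set Z}
    (hS : IsClosed S) (hc : Convex ℝ S) (hv : ∃ᶠ k in atTop, v k ∈ S) : w ∈ S := by
  by_contra hw
  obtain ⟨φ, u, h1, h2⟩ := geometric_hahn_banach_closed_point hc hS hw
  have h3 : ∀ᶠ k in atTop, u < φ (v k) := (h φ).eventually (lt_mem_nhds h2)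
  obtain ⟨k, hk1, hk2⟩ := (hv.and_eventually h3).exists
  exact lt_asymm (h1 _ hk1) hk2

/-- Continuous convex functions are weakly sequentially lower semicontinuous. -/
theorem WeakTendsto.eventually_lt {v : ℕ → Z} {w : Z} (h : WeakTendsto v w) {g : Z → ℝ}
    (hg : ConvexOn ℝ Set.univ g) (hgc : Continuous g) {a : ℝ} (ha : a < g w) :
    ∀ᶠ k in atTop, a < g (v k) := by
  by_contra hc
  rw [not_eventually] at hc
  have h1 : w ∈ {z ∈ Set.univ | g z ≤ a} :=
    h.mem_of_frequently (by simpa using isClosed_le hgc continuous_const) (hg.convex_le a)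
      (hc.mono fun k hk => ⟨trivial, not_lt.1 hk⟩)
  exact absurd h1.2 (not_le.2 ha)

theorem WeakTendsto.le_of_tendsto {v : ℕ → Z} {w : Z} (h : WeakTendsto v w) {g : Z → ℝ}
    (hg : ConvexOn ℝ Set.univ g) (hgc : Continuous g) {a : ℝ}
    (ha : Tendsto (fun k => g (v k)) atTop (𝓝 a)) : g w ≤ a :=
  le_of_forall_lt_imp_le_of_dense fun _ hb =>
    ge_of_tendsto ha ((h.eventually_lt hg hgc hb).mono fun _ hk => hk.le)

end WeakCompactness

/-! ### Stability of minimizers and optimal values. -/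

section Deterministic

variable {Z : Type*}

theorem optValue_eq_of_minimizer {S : Set Z} {J : Z → ℝ} {w : Z} (hw : w ∈ S)
    (h : ∀ x ∈ S, J w ≤ J x) : optValue S J = J w :=
  le_antisymm (iInf₂_le w hw) (le_iInf₂ fun x hx => EReal.coe_le_coe_iff.2 (h x hx))

/-- Convergence of optimal values under a uniform lower bound and pointwise convergence at a
minimizer. -/
theorem tendsto_optValue {S : Set Z} {J : Z → ℝ} {Jn : ℕ → Z → ℝ} {w : Z} (hw : w ∈ S)
    (hmin : ∀ x ∈ S, J w ≤ J x) (hlow : ∀ η > 0, ∀ᶠ n in atTop, ∀ x ∈ S, J x - η ≤ Jn n x)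
    (hup : Tendsto (fun n => Jn n w) atTop (𝓝 (J w))) :
    Tendsto (fun n => optValue S (Jn n)) atTop (𝓝 (optValue S J)) := by
  rw [optValue_eq_of_minimizer hw hmin]
  refine tendsto_order.2 ⟨fun b hb => ?_, fun b hb => ?_⟩
  · obtain ⟨r, hbr, hrJ⟩ := EReal.lt_iff_exists_real_btwn.1 hb
    have hr := EReal.coe_lt_coe_iff.1 hrJ
    filter_upwards [hlow (J w - r) (sub_pos.2 hr)] with n hn
    refine hbr.trans_le (le_iInf₂ fun x hx => EReal.coe_le_coe_iff.2 ?_)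
    linarith [hn x hx, hmin x hx]
  · filter_upwards [((continuous_coe_real_ereal.tendsto _).comp hup).eventually (gt_mem_nhds hb)]
      with n hn
    exact (iInf₂_le w hw).trans_lt hn

variable [NormedAddCommGroup Z] [NormedSpace ℝ Z] [TopologicalSpace.SeparableSpace Z]
  {Y : Type*} [NormedAddCommGroup Y]

/-- Completely continuous operators map bounded closed convex sets of a separable reflexive space
to compact sets. -/
theorem CompletelyContinuous.isCompact_image (hZ : IsReflexive Z) {B : Z → Y}
    (hB : CompletelyContinuous B) {S : Set Z} (hS : IsClosed S) (hc : Convex ℝ S)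
    (hb : Bornology.IsBounded S) : IsCompact (B '' S) := by
  refine IsSeqCompact.isCompact fun y hy => ?_
  choose z hzS hzy using hy
  obtain ⟨w, k, hk, hw⟩ := exists_weakTendsto_subseq hZ
    (hb.subset (Set.range_subset_iff.2 hzS))
  refine ⟨B w, ⟨w, hw.mem_of_frequently hS hc (Frequently.of_forall fun n => hzS _), rfl⟩, k, hk, ?_⟩
  have := hB _ _ hw
  simpa only [Function.comp_def, hzy] using this

/-- Minimizing sequences of `a ∘ B + g` have weak cluster points, which are minimizers, along which
the values of `g` converge. -/
theorem exists_subseq_of_minimizing (hZ : IsReflexive Z) {B : Z → Y}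
    (hB : CompletelyContinuous B) {S : Set Z} (hS : IsClosed S) (hc : Convex ℝ S)
    (hb : Bornology.IsBounded S) {a : Y → ℝ} (ha : ContinuousOn a (B '' S)) {g : Z → ℝ}
    (hg : ConvexOn ℝ Set.univ g) (hgc : Continuous g) {z : ℕ → Z} (hz : ∀ k, z k ∈ S) {m : ℝ}
    (hm : ∀ x ∈ S, m ≤ a (B x) + g x)
    (hlim : Tendsto (fun k => a (B (z k)) + g (z k)) atTop (𝓝 m)) :
    ∃ w ∈ S, ∃ k : ℕ → ℕ, StrictMono k ∧ WeakTendsto (z ∘ k) w ∧ a (B w) + g w = m ∧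
      Tendsto (fun n => g (z (k n))) atTop (𝓝 (g w)) := by
  obtain ⟨w, k, hk, hw⟩ := exists_weakTendsto_subseq hZ
    (hb.subset (Set.range_subset_iff.2 hz))
  have hwS : w ∈ S := hw.mem_of_frequently hS hc (Frequently.of_forall fun n => hz _)
  have h1 : Tendsto (fun n => a (B (z (k n)))) atTop (𝓝 (a (B w))) :=
    (ha (B w) ⟨w, hwS, rfl⟩).tendsto.comp (tendsto_nhdsWithin_iff.2
      ⟨hB _ _ hw, Eventually.of_forall fun n => ⟨_, hz _, rfl⟩⟩)
  -- The total converges to `m` and the `a`-part to `a (B w)`, so `g` converges along the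
  -- subsequence. Weak lower semicontinuity bounds `g w` above by this limit, and minimality of `m`
  -- bounds it below.
  have h2 : Tendsto (fun n => g (z (k n))) atTop (𝓝 (m - a (B w))) := by
    have := (hlim.comp hk.tendsto_atTop).sub h1
    simpa [Function.comp_def] using this
  have h3 := hw.le_of_tendsto hg hgc h2
  have h4 := hm w hwS
  have h5 : g w = m - a (B w) := by linarith
  exact ⟨w, hwS, k, hk, hw, by linarith, h5 ▸ h2⟩

/-- The direct method: compactness of the image bounds `a` below and `g` is nonnegative, so the
infimum is finite and a minimizing sequence has a minimizer as weak cluster point. -/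
theorem exists_minimizer (hZ : IsReflexive Z) {B : Z → Y}
    (hB : CompletelyContinuous B) {S : Set Z} (hne : S.Nonempty) (hS : IsClosed S)
    (hc : Convex ℝ S) (hb : Bornology.IsBounded S) {a : Y → ℝ} (ha : ContinuousOn a (B '' S))
    {g : Z → ℝ} (hg0 : ∀ z, 0 ≤ g z) (hg : ConvexOn ℝ Set.univ g) (hgc : Continuous g) :
    ∃ w ∈ S, ∀ x ∈ S, a (B w) + g w ≤ a (B x) + g x := by
  obtain ⟨b, hbK⟩ := ((hB.isCompact_image hZ hS hc hb).image_of_continuousOn ha).bddBelow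
  let I : Set ℝ := (fun x => a (B x) + g x) '' S
  have hI : BddBelow I := ⟨b, by
    rintro _ ⟨x, hx, rfl⟩
    have := hbK ⟨B x, ⟨x, hx, rfl⟩, rfl⟩
    have := hg0 x
    show b ≤ a (B x) + g x
    linarith⟩
  obtain ⟨u, -, hu, huI⟩ := exists_seq_tendsto_sInf (hne.image _) hI
  choose z hzS hzu using huI
  have hm : ∀ x ∈ S, sInf I ≤ a (B x) + g x := fun x hx => csInf_le hI ⟨x, hx, rfl⟩
  obtain ⟨w, hwS, -, -, -, hw, -⟩ := exists_subseq_of_minimizing hZ hB hS hc hb ha hg hgc hzS hm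
    (by simpa only [hzu] using hu)
  exact ⟨w, hwS, fun x hx => hw ▸ hm x hx⟩

/-- Convergence of solution sets under a uniform lower bound and pointwise convergence at a
minimizer, when the regularizer is an R-function. -/
theorem tendsto_deviation (hZ : IsReflexive Z) {B : Z → Y}
    (hB : CompletelyContinuous B) {S : Set Z} (hS : IsClosed S)
    (hc : Convex ℝ S) (hb : Bornology.IsBounded S) {a : Y → ℝ} (ha : ContinuousOn a (B '' S))
    {g : Z → ℝ} (hg : IsRFunction g) {J : Z → ℝ} (hJ : ∀ z, J z = a (B z) + g z)
    {Jn : ℕ → Z → ℝ} {w : Z} (hw : w ∈ S)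
    (hmin : ∀ x ∈ S, J w ≤ J x) (hlow : ∀ η > 0, ∀ᶠ n in atTop, ∀ x ∈ S, J x - η ≤ Jn n x)
    (hup : Tendsto (fun n => Jn n w) atTop (𝓝 (J w))) :
    Tendsto (fun n => deviation (solutionSet S (Jn n)) (solutionSet S J)) atTop (𝓝 0) := by
  obtain rfl : J = fun z => a (B z) + g z := funext hJ
  refine tendsto_order.2 ⟨fun b hb => absurd hb not_lt_zero, fun r hr => ?_⟩
  by_contra hcon
  rw [not_eventually] at hcon
  obtain ⟨r', hr'0, hr'⟩ := exists_between hr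
  have hcon' : ∃ᶠ n in atTop, ∃ x ∈ solutionSet S (Jn n),
      r' < Metric.infEDist x (solutionSet S fun z => a (B z) + g z) := by
    refine hcon.mono fun n hn => ?_
    have h1 := hr'.trans_le (not_lt.1 hn)
    simpa only [deviation, lt_iSup_iff, exists_prop] using h1
  obtain ⟨k, hk, hkx⟩ := extraction_of_frequently_atTop hcon'
  choose z hzsol hzd using hkx
  have hzS : ∀ n, z n ∈ S := fun n => (hzsol n).1
  have hle : ∀ n, Jn (k n) (z n) ≤ Jn (k n) w := fun n => by
    rw [← EReal.coe_le_coe_iff, (hzsol n).2]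
    exact iInf₂_le w hw
  -- Squeeze: J(w) ≤ J(z n) ≤ Jn(z n) + η ≤ Jn(w) + η, where Jn(w) tends to J(w).
  have hlim : Tendsto (fun n => a (B (z n)) + g (z n)) atTop (𝓝 (a (B w) + g w)) := by
    refine tendsto_order.2 ⟨fun b hb => Eventually.of_forall fun n => hb.trans_le (hmin _ (hzS n)),
      fun b hb => ?_⟩
    have hη : 0 < (b - (a (B w) + g w)) / 2 := by linarith
    filter_upwards [hk.tendsto_atTop.eventually (hlow _ hη),
      (hup.comp hk.tendsto_atTop).eventually (gt_mem_nhds (lt_add_of_pos_right _ hη))]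
      with n h1 h2
    have h3 := h1 _ (hzS n)
    have h4 := hle n
    simp only [Function.comp_apply] at h2
    linarith
  obtain ⟨v, hvS, l, hl, hweak, hv, hgv⟩ := exists_subseq_of_minimizing hZ hB hS hc hb ha
    hg.convex hg.continuous hzS hmin hlim
  have hstrong := hg.strong _ _ hweak hgv
  have hvsol : v ∈ solutionSet S fun z => a (B z) + g z :=
    ⟨hvS, (congrArg _ hv).trans
      (optValue_eq_of_minimizer (J := fun z => a (B z) + g z) hw hmin).symm⟩
  have h5 := (tendsto_iff_edist_tendsto_0.1 hstrong).eventually (gt_mem_nhds hr'0)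
  obtain ⟨n, hn⟩ := h5.exists
  exact lt_asymm hn ((hzd (l n)).trans_le (Metric.infEDist_le_edist_of_mem hvsol))

end Deterministic

/-! ### Nonatomic measures and realization of empirical laws. -/

section Sierpinski

variable {Ω : Type*} [MeasurableSpace Ω] {P : Measure Ω} [IsFiniteMeasure P]

/-- Split `A` in two pieces of positive measure and keep the smaller. Iteration yields subsets of
arbitrarily small positive measure. -/
theorem Nonatomic.exists_subset_half (hP : Nonatomic P) {A : Set Ω} (hA : MeasurableSet A)
    (h0 : 0 < P.real A) : ∃ B ⊆ A, MeasurableSet B ∧ 0 < P.real B ∧ P.real B ≤ P.real A / 2 := by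
  obtain ⟨B, hBA, hB, hB0, hlt⟩ := hP A hA (ENNReal.toReal_pos_iff.1 h0).1
  have hB0' : 0 < P.real B := ENNReal.toReal_pos hB0.ne' (measure_ne_top _ _)
  have hlt' : P.real B < P.real A := (ENNReal.toReal_lt_toReal (measure_ne_top _ _)
    (measure_ne_top _ _)).2 hlt
  have hd : P.real (A \ B) = P.real A - P.real B := measureReal_sdiff hBA hB
  rcases le_total (P.real B) (P.real A / 2) with h | h
  · exact ⟨B, hBA, hB, hB0', h⟩
  · exact ⟨A \ B, Set.sdiff_subset, hA.diff hB, by linarith, by linarith⟩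

theorem Nonatomic.exists_subset_lt (hP : Nonatomic P) {A : Set Ω} (hA : MeasurableSet A)
    (h0 : 0 < P.real A) {δ : ℝ} (hδ : 0 < δ) :
    ∃ B ⊆ A, MeasurableSet B ∧ 0 < P.real B ∧ P.real B < δ := by
  have key : ∀ n : ℕ, ∃ B ⊆ A, MeasurableSet B ∧ 0 < P.real B ∧
      P.real B ≤ P.real A * (1 / 2) ^ n := by
    intro n
    induction n with
    | zero => exact ⟨A, subset_rfl, hA, h0, by simp⟩
    | succ n ih =>
      obtain ⟨B, hBA, hB, hB0, hle⟩ := ih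
      obtain ⟨C, hCB, hC, hC0, hC2⟩ := hP.exists_subset_half hB hB0
      refine ⟨C, hCB.trans hBA, hC, hC0, ?_⟩
      rw [pow_succ]
      linarith
  have hlim : Tendsto (fun n : ℕ => P.real A * (1 / 2) ^ n) atTop (𝓝 (P.real A * 0)) :=
    (tendsto_pow_atTop_nhds_zero_of_lt_one (by norm_num) (by norm_num)).const_mul _
  rw [mul_zero] at hlim
  obtain ⟨n, hn⟩ := (hlim.eventually (gt_mem_nhds hδ)).exists
  obtain ⟨B, hBA, hB, hB0, hle⟩ := key n
  exact ⟨B, hBA, hB, hB0, hle.trans_lt hn⟩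

/-- Sierpiński's theorem: a finite nonatomic measure takes all intermediate values. -/
theorem Nonatomic.exists_subset_eq (hP : Nonatomic P) {A : Set Ω} (hA : MeasurableSet A)
    {c : ℝ} (hc0 : 0 ≤ c) (hcA : c ≤ P.real A) :
    ∃ B ⊆ A, MeasurableSet B ∧ P.real B = c := by
  let T := {B : Set Ω // B ⊆ A ∧ MeasurableSet B ∧ P.real B ≤ c}
  let V : T → Set ℝ := fun B => {r | ∃ C : T, B.1 ⊆ C.1 ∧ P.real C.1 = r}
  have hV : ∀ B, BddAbove (V B) := fun B => ⟨c, by rintro _ ⟨C, -, rfl⟩; exact C.2.2.2⟩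
  -- Greedy exhaustion: each step realizes at least half of the largest gain still available under
  -- the cap `c`.
  have hnext : ∀ B : T, ∃ C : T, B.1 ⊆ C.1 ∧ (P.real B.1 + sSup (V B)) / 2 ≤ P.real C.1 := by
    intro B
    have hBV : P.real B.1 ∈ V B := ⟨B, subset_rfl, rfl⟩
    rcases (le_csSup (hV B) hBV).eq_or_lt with h | h
    · exact ⟨B, subset_rfl, by rw [← h]; linarith⟩
    · obtain ⟨_, ⟨C, hBC, rfl⟩, hlt⟩ := exists_lt_of_lt_csSup ⟨_, hBV⟩
        (show (P.real B.1 + sSup (V B)) / 2 < sSup (V B) by linarith)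
      exact ⟨C, hBC, hlt.le⟩
  choose next hn1 hn2 using hnext
  let B₀ : T := ⟨∅, Set.empty_subset _, MeasurableSet.empty, by simpa using hc0⟩
  let B : ℕ → T := fun n => next^[n] B₀
  have hB : ∀ n, B (n + 1) = next (B n) := fun n => Function.iterate_succ_apply' _ _ _
  have hmono : Monotone fun n => (B n).1 := monotone_nat_of_le_succ fun n => by
    rw [hB]; exact hn1 _
  let U := ⋃ n, (B n).1
  have hU : MeasurableSet U := MeasurableSet.iUnion fun n => (B n).2.2.1
  have hUA : U ⊆ A := Set.iUnion_subset fun n => (B n).2.1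
  have hlim : Tendsto (fun n => P.real (B n).1) atTop (𝓝 (P.real U)) :=
    (ENNReal.tendsto_toReal (measure_ne_top _ _)).comp (tendsto_measure_iUnion_atTop hmono)
  have hUc : P.real U ≤ c := le_of_tendsto' hlim fun n => (B n).2.2.2
  refine ⟨U, hUA, hU, hUc.antisymm ?_⟩
  by_contra hlt
  rw [not_le] at hlt
  have hd : P.real (A \ U) = P.real A - P.real U := measureReal_sdiff hUA hU
  obtain ⟨C, hCA, hC, hC0, hClt⟩ := hP.exists_subset_lt (hA.diff hU) (by linarith)
    (sub_pos.2 hlt)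
  have hUC : P.real (U ∪ C) = P.real U + P.real C :=
    measureReal_union (Set.disjoint_left.2 fun ω h1 h2 => (hCA h2).2 h1) hC
  let D : T := ⟨U ∪ C, Set.union_subset hUA (hCA.trans Set.sdiff_subset), hU.union hC, by linarith⟩
  -- If the union `U` fell short of `c`, a small `C` could still be added, so `U ∪ C` competes at
  -- every step. In the limit P(U) ≥ P(U) + P(C)/2, which is absurd.
  have hstep : ∀ n, (P.real (B n).1 + (P.real U + P.real C)) / 2 ≤ P.real (B (n + 1)).1 := by
    intro n
    have h1 : P.real U + P.real C ≤ sSup (V (B n)) := le_csSup (hV _)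
      ⟨D, (Set.subset_iUnion (fun n => (B n).1) n).trans Set.subset_union_left, hUC⟩
    have h2 := hn2 (B n)
    rw [hB]
    linarith
  have h3 := le_of_tendsto_of_tendsto' ((hlim.add_const _).div_const 2)
    (hlim.comp (tendsto_add_atTop_nat 1)) hstep
  linarith

theorem Nonatomic.exists_equipartition (hP : Nonatomic P) {δ : ℝ} (hδ : 0 ≤ δ) (n : ℕ) :
    ∀ A : Set Ω, MeasurableSet A → P.real A = n * δ →
      ∃ E : ℕ → Set Ω, (∀ i, MeasurableSet (E i)) ∧ (∀ i, E i ⊆ A) ∧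
        Pairwise (Function.onFun Disjoint E) ∧ ∀ i < n, P.real (E i) = δ := by
  induction n with
  | zero => exact fun A _ _ => ⟨fun _ => ∅, fun _ => MeasurableSet.empty,
      fun _ => Set.empty_subset _, fun _ _ _ => Set.disjoint_empty _, fun i hi => by omega⟩
  | succ n ih =>
    intro A hA hAn
    push_cast at hAn
    obtain ⟨B, hBA, hB, hBδ⟩ := hP.exists_subset_eq hA hδ
      (by rw [hAn]; nlinarith [mul_nonneg (Nat.cast_nonneg (α := ℝ) n) hδ])
    obtain ⟨E, hE, hEA, hEd, hEδ⟩ := ih (A \ B) (hA.diff hB)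
      (by rw [measureReal_sdiff hBA hB, hAn, hBδ]; ring)
    have hBE : ∀ i, Disjoint B (E i) := fun i =>
      Set.disjoint_left.2 fun ω h1 h2 => (hEA i h2).2 h1
    refine ⟨fun i => if i = n then B else E i, fun i => ?_, fun i => ?_, fun i j hij => ?_,
      fun i hi => ?_⟩
    · dsimp only; split_ifs <;> simp [hB, hE]
    · dsimp only; split_ifs
      · exact hBA
      · exact (hEA i).trans Set.sdiff_subset
    · dsimp only [Function.onFun]; split_ifs with h1 h2 h2
      · exact absurd (h1.trans h2.symm) hij
      · exact hBE j
      · exact (hBE i).symm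
      · exact hEd hij
    · dsimp only; split_ifs with h1
      · exact hBδ
      · exact hEδ i (by omega)

/-- On a nonatomic probability space, every empirical distribution is the law of some square
integrable random variable. -/
theorem Nonatomic.exists_lp_empirical {P : Measure Ω} [IsProbabilityMeasure P] (hP : Nonatomic P)
    (x : ℕ → ℝ) {N : ℕ} (hN : N ≠ 0) : ∃ X : Lp ℝ 2 P, ∀ v : ℝ → ℝ,
      ∫ ω, v (X ω) ∂P = (N : ℝ)⁻¹ * ∑ i ∈ Finset.range N, v (x i) := by
  have hN' : (N : ℝ) ≠ 0 := Nat.cast_ne_zero.2 hN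
  -- N disjoint cells of mass 1/N; `X` takes the value `x i` on the i-th cell.
  obtain ⟨E, hE, -, hEd, hEδ⟩ := hP.exists_equipartition (δ := (N : ℝ)⁻¹) (by positivity) N
    Set.univ MeasurableSet.univ (by rw [probReal_univ, mul_inv_cancel₀ hN'])
  let X : Ω → ℝ := fun ω => ∑ i ∈ Finset.range N, (E i).indicator (fun _ => x i) ω
  have hX : MemLp X 2 P := memLp_finsetSum _ fun i _ =>
    memLp_indicator_const 2 (hE i) (x i) (Or.inr (measure_ne_top _ _))
  have hXE : ∀ i < N, ∀ ω ∈ E i, X ω = x i := by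
    intro i hi ω hω
    refine (Finset.sum_eq_single_of_mem i (Finset.mem_range.2 hi) fun j _ hji => ?_).trans
      (Set.indicator_of_mem hω _)
    exact Set.indicator_of_notMem (Set.disjoint_left.1 (hEd hji.symm) hω) _
  refine ⟨hX.toLp X, fun v => ?_⟩
  have hdisj : Set.PairwiseDisjoint ((Finset.range N : Finset ℕ) : Set ℕ) E :=
    fun i _ j _ hij => hEd hij
  have hU : MeasurableSet (⋃ i ∈ Finset.range N, E i) :=
    Finset.measurableSet_biUnion _ fun i _ => hE i
  have hfull : (⋃ i ∈ Finset.range N, E i) =ᵐ[P] Set.univ := by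
    rw [ae_eq_univ, ← measureReal_eq_zero_iff, probReal_compl_eq_one_sub hU,
      measureReal_biUnion_finset hdisj fun i _ => hE i,
      Finset.sum_congr rfl fun i hi => hEδ i (Finset.mem_range.1 hi)]
    simp [hN']
  have hconst : ∀ i ∈ Finset.range N, Set.EqOn (fun ω => v (X ω)) (fun _ => v (x i)) (E i) :=
    fun i hi ω hω => congrArg v (hXE i (Finset.mem_range.1 hi) ω hω)
  calc ∫ ω, v (hX.toLp X ω) ∂P = ∫ ω, v (X ω) ∂P :=
        integral_congr_ae (hX.coeFn_toLp.fun_comp v)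
    _ = ∫ ω in ⋃ i ∈ Finset.range N, E i, v (X ω) ∂P := by
        rw [setIntegral_congr_set hfull, setIntegral_univ]
    _ = ∑ i ∈ Finset.range N, ∫ ω in E i, v (X ω) ∂P :=
        integral_biUnion_finset _ (fun i _ => hE i) hdisj fun i hi =>
          (integrableOn_const (measure_ne_top _ _)).congr_fun (hconst i hi).symm (hE i)
    _ = ∑ i ∈ Finset.range N, (N : ℝ)⁻¹ * v (x i) := by
        refine Finset.sum_congr rfl fun i hi => ?_
        rw [setIntegral_congr_fun (hE i) (hconst i hi), setIntegral_const,
          hEδ i (Finset.mem_range.1 hi), smul_eq_mul]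
    _ = _ := (Finset.mul_sum _ _ _).symm

end Sierpinski

/-! ### AVaR as a functional of the tail, and the regularization error. -/

section Tails

/-- The infimum `inf_t { t + c q(t) }`. -/
def infTail (c : ℝ) (q : ℝ → ℝ) : ℝ := ⨅ t : ℝ, (t + c * q t)

/-- A function which is nonnegative and bounded below by some `m - t`. -/
def IsTail (q : ℝ → ℝ) : Prop := (∀ t, 0 ≤ q t) ∧ ∃ m : ℝ, ∀ t, m - t ≤ q t

/-- Since c ≥ 1 and q ≥ 0, t + c q(t) ≥ t + q(t) ≥ m. Without this bound the real infimum would take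
its default value 0. -/
theorem IsTail.bddBelow {q : ℝ → ℝ} (hq : IsTail q) {c : ℝ} (hc : 1 ≤ c) :
    BddBelow (Set.range fun t => t + c * q t) := by
  obtain ⟨h0, m, hm⟩ := hq
  refine ⟨m, ?_⟩
  rintro _ ⟨t, rfl⟩
  have := h0 t
  have := hm t
  dsimp only
  nlinarith

theorem infTail_le_add {q q' : ℝ → ℝ} (hq : IsTail q) {c : ℝ} (hc : 1 ≤ c) {δ : ℝ}
    (h : ∀ t, q t ≤ q' t + δ) : infTail c q ≤ infTail c q' + c * δ := by
  rw [← sub_le_iff_le_add]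
  refine le_ciInf fun t => ?_
  have h1 : infTail c q ≤ t + c * q t := ciInf_le (hq.bddBelow hc) t
  have := mul_le_mul_of_nonneg_left (h t) (zero_le_one.trans hc)
  linarith

theorem infTail_mono {q q' : ℝ → ℝ} (hq : IsTail q) {c : ℝ} (hc : 1 ≤ c)
    (h : ∀ t, q t ≤ q' t) : infTail c q ≤ infTail c q' := by
  simpa using infTail_le_add hq hc (δ := 0) (by simpa using h)

theorem abs_infTail_sub_le {q q' : ℝ → ℝ} (hq : IsTail q) (hq' : IsTail q') {c : ℝ} (hc : 1 ≤ c)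
    {δ : ℝ} (h : ∀ t, |q t - q' t| ≤ δ) : |infTail c q - infTail c q'| ≤ c * δ := by
  have h1 := infTail_le_add hq hc (q' := q') (δ := δ) fun t => by
    have := (abs_le.1 (h t)).2; linarith
  have h2 := infTail_le_add hq' hc (q' := q) (δ := δ) fun t => by
    have := (abs_le.1 (h t)).1; linarith
  rw [abs_le]
  constructor <;> linarith

theorem one_le_one_div_one_sub {β : ℝ} (hβ0 : 0 ≤ β) (hβ1 : β < 1) : 1 ≤ 1 / (1 - β) := by
  rw [le_div_iff₀ (by linarith)]; linarith

/-- The tail expectation `t ↦ E[max(0, X - t)]`. -/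
def tail {Ω : Type*} [MeasurableSpace Ω] (P : Measure Ω) (X : Ω → ℝ) (t : ℝ) : ℝ :=
  ∫ ω, max 0 (X ω - t) ∂P

/-- The tail average `t ↦ (1/N) ∑ max(0, x i - t)`. -/
def empTail (x : ℕ → ℝ) (N : ℕ) (t : ℝ) : ℝ :=
  (N : ℝ)⁻¹ * ∑ i ∈ Finset.range N, max 0 (x i - t)

theorem isTail_empTail (x : ℕ → ℝ) {N : ℕ} (hN : N ≠ 0) : IsTail (empTail x N) := by
  have hN' : (N : ℝ) ≠ 0 := Nat.cast_ne_zero.2 hN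
  have hN0 : (0 : ℝ) ≤ (N : ℝ)⁻¹ := by positivity
  refine ⟨fun t => mul_nonneg hN0 (Finset.sum_nonneg fun i _ => le_max_left _ _),
    (N : ℝ)⁻¹ * ∑ i ∈ Finset.range N, x i, fun t => ?_⟩
  have h1 : ∑ i ∈ Finset.range N, (x i - t) ≤ ∑ i ∈ Finset.range N, max 0 (x i - t) :=
    Finset.sum_le_sum fun i _ => le_max_right _ _
  have h2 := mul_le_mul_of_nonneg_left h1 hN0
  rw [Finset.sum_sub_distrib, Finset.sum_const, Finset.card_range, nsmul_eq_mul, mul_sub,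
    inv_mul_cancel_left₀ hN'] at h2
  exact h2

theorem empTail_mono {x y : ℕ → ℝ} (h : ∀ i, x i ≤ y i) (N : ℕ) (t : ℝ) :
    empTail x N t ≤ empTail y N t :=
  mul_le_mul_of_nonneg_left (Finset.sum_le_sum fun i _ =>
    max_le_max le_rfl (sub_le_sub_right (h i) t)) (by positivity)

variable {Ω : Type*} [MeasurableSpace Ω] {P : Measure Ω} [IsProbabilityMeasure P]

theorem integrable_max_zero_sub {X : Ω → ℝ} (hX : Integrable X P) (t : ℝ) :
    Integrable (fun ω => max 0 (X ω - t)) P :=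
  (integrable_zero Ω ℝ P).sup (hX.sub (integrable_const t))

theorem isTail_tail {X : Ω → ℝ} (hX : Integrable X P) : IsTail (tail P X) := by
  refine ⟨fun t => integral_nonneg fun ω => le_max_left _ _, ∫ ω, X ω ∂P, fun t => ?_⟩
  have h2 : ∫ ω, (X ω - t) ∂P ≤ ∫ ω, max 0 (X ω - t) ∂P :=
    integral_mono (hX.sub (integrable_const t)) (integrable_max_zero_sub hX t)
      fun ω => le_max_right _ _
  rw [integral_sub hX (integrable_const t), integral_const, probReal_univ, one_smul] at h2
  exact h2

omit [IsProbabilityMeasure P] in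
theorem tail_congr {X X' : Ω → ℝ} (h : X =ᵐ[P] X') : tail P X = tail P X' := by
  funext t
  exact integral_congr_ae (h.fun_comp fun r => max 0 (r - t))

theorem abs_tail_sub_le {X X' : Ω → ℝ} (hX : Integrable X P) (hX' : Integrable X' P) (t : ℝ) :
    |tail P X t - tail P X' t| ≤ ∫ ω, |X ω - X' ω| ∂P := by
  rw [tail, tail, ← integral_sub (integrable_max_zero_sub hX t) (integrable_max_zero_sub hX' t)]
  refine (abs_integral_le_integral_abs).trans (integral_mono
    ((integrable_max_zero_sub hX t).sub (integrable_max_zero_sub hX' t)).abs (hX.sub hX').abs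
    fun ω => ?_)
  have := abs_max_sub_max_le_max 0 (X ω - t) 0 (X' ω - t)
  simpa using this

theorem abs_infTail_tail_sub_le {X X' : Ω → ℝ} (hX : Integrable X P) (hX' : Integrable X' P)
    {c : ℝ} (hc : 1 ≤ c) :
    |infTail c (tail P X) - infTail c (tail P X')| ≤ c * ∫ ω, |X ω - X' ω| ∂P :=
  abs_infTail_sub_le (isTail_tail hX) (isTail_tail hX') hc (abs_tail_sub_le hX hX')

omit [IsProbabilityMeasure P] in
theorem avar_eq_infTail (β : ℝ) (X : Lp ℝ 2 P) : avar β X = infTail (1 / (1 - β)) (tail P X) := rfl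

omit [IsProbabilityMeasure P] in
theorem avar_toL2 (β : ℝ) {X : Ω → ℝ} (hX : MemLp X 2 P) :
    avar β (toL2 P X) = infTail (1 / (1 - β)) (tail P X) := by
  rw [avar_eq_infTail, toL2, dif_pos hX, tail_congr hX.coeFn_toLp]

/-- Test the infimal convolution at 0, where the regularizer vanishes. -/
theorem epiAvar_le_avar {β ε : ℝ} (hβ0 : 0 ≤ β) (hβ1 : β < 1) (hε : 0 < ε) (X : Lp ℝ 2 P) :
    epiAvar β ε X ≤ avar β X := by
  have h1 : epiAvar β ε X ≤ avar β (X - 0) + ε * regPhi (ε⁻¹ • (0 : Lp ℝ 2 P)) :=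
    ciInf_le (epiAvar_bddBelow hβ0 hβ1 hε X) 0
  have h2 : ∫ ω, (((0 : Lp ℝ 2 P) ω) ^ 2 / (2 * ε) + (0 : Lp ℝ 2 P) ω) ∂P = 0 := by
    refine integral_eq_zero_of_ae ?_
    filter_upwards [Lp.coeFn_zero ℝ 2 P] with ω hω
    rw [hω]
    simp
  rwa [reg_eq hε, h2, sub_zero, add_zero] at h1

/-- Replacing X by X - Y lowers AVaR by at most c E|Y|, and the quadratic penalty absorbs this
linear loss up to a multiple of ε. -/
theorem avar_sub_le_epiAvar {β ε : ℝ} (hβ0 : 0 ≤ β) (hβ1 : β < 1) (hε : 0 < ε) (X : Lp ℝ 2 P) :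
    avar β X - (1 + 1 / (1 - β)) ^ 2 / 2 * ε ≤ epiAvar β ε X := by
  have hc := one_le_one_div_one_sub hβ0 hβ1
  refine le_ciInf fun Y => ?_
  have h1 := (abs_le.1 (abs_infTail_tail_sub_le (integrable_l2 X) (integrable_l2 (X - Y)) hc)).2
  rw [← avar_eq_infTail, ← avar_eq_infTail] at h1
  have h2 : ∫ ω, |X ω - (X - Y) ω| ∂P = ∫ ω, |Y ω| ∂P := by
    refine integral_congr_ae ?_
    filter_upwards [Lp.coeFn_sub X Y] with ω hω
    rw [hω, Pi.sub_apply, sub_sub_cancel]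
  rw [h2] at h1
  rw [reg_eq hε]
  generalize 1 / (1 - β) = c at *
  have h3 : ∫ ω, (c * |Y ω| - (1 + c) ^ 2 / 2 * ε) ∂P ≤ ∫ ω, ((Y ω) ^ 2 / (2 * ε) + Y ω) ∂P := by
    refine integral_mono (((integrable_l2 Y).abs.const_mul c).sub (integrable_const _))
      (((Lp.memLp Y).integrable_sq.div_const _).add (integrable_l2 Y)) fun ω => ?_
    -- Completing the square in y²/(2ε) - (1+c)|y|: one |y| comes from the linear term of Φ, c|y|
    -- from the Lipschitz bound.
    have h4 : 0 ≤ (|Y ω| - (1 + c) * ε) ^ 2 / (2 * ε) := by positivity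
    have h5 : (|Y ω| - (1 + c) * ε) ^ 2 / (2 * ε) =
        (Y ω) ^ 2 / (2 * ε) - (1 + c) * |Y ω| + (1 + c) ^ 2 / 2 * ε := by
      rw [← sq_abs (Y ω)]
      field_simp
      ring
    have h6 := neg_abs_le (Y ω)
    dsimp only
    linarith
  rw [integral_sub ((integrable_l2 Y).abs.const_mul c) (integrable_const _), integral_const_mul,
    integral_const, probReal_univ, one_smul] at h3
  linarith

/-- The epi-regularized average value-at-risk of an empirical distribution is close to the average
value-at-risk of the sample. -/
theorem abs_atDistribution_epiAvar_sub_le (hP : Nonatomic P) {β ε : ℝ} (hβ0 : 0 ≤ β) (hβ1 : β < 1)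
    (hε : 0 < ε) (x : ℕ → ℝ) {N : ℕ} (hN : N ≠ 0) :
    |atDistribution (P := P) (epiAvar β ε) (empiricalCDF x N) -
      infTail (1 / (1 - β)) (empTail x N)| ≤ (1 + 1 / (1 - β)) ^ 2 / 2 * ε := by
  obtain ⟨X, hX⟩ := hP.exists_lp_empirical x hN
  have hcdf : ∀ t : ℝ, P.real {ω | X ω ≤ t} = empiricalCDF x N t := by
    intro t
    rw [empiricalCDF, ← hX, ← integral_indicator_one
      (measurableSet_le (Lp.stronglyMeasurable X).measurable measurable_const)]
    rfl
  have htail : tail P X = empTail x N := funext fun t => hX fun r => max 0 (r - t)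
  rw [atDistribution_eq (epiAvar_lawInvariant hβ0 hβ1 hε) X hcdf, ← htail, ← avar_eq_infTail,
    abs_le]
  have h1 := epiAvar_le_avar hβ0 hβ1 hε X
  have h2 := avar_sub_le_epiAvar hβ0 hβ1 hε X
  have h3 : 0 ≤ (1 + 1 / (1 - β)) ^ 2 / 2 * ε := by positivity
  constructor <;> linarith

end Tails

/-! ### A strong law uniform in the threshold t. -/

section LawOfLargeNumbers

open scoped BoundedContinuousFunction

/-- The bounded continuous function `t ↦ max(0, x - t) - max(0, -t)`. -/
def tailFun (x : ℝ) : ℝ →ᵇ ℝ :=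
  BoundedContinuousFunction.ofNormedAddCommGroup (fun t => max 0 (x - t) - max 0 (-t))
    (by fun_prop) |x| fun t => by
      have := abs_max_sub_max_le_max 0 (x - t) 0 (-t)
      simpa using this

theorem tailFun_apply (x t : ℝ) : tailFun x t = max 0 (x - t) - max 0 (-t) := rfl

theorem norm_tailFun_le (x : ℝ) : ‖tailFun x‖ ≤ |x| :=
  BoundedContinuousFunction.norm_ofNormedAddCommGroup_le _ (abs_nonneg x) _

/-- The map is 1-Lipschitz. Continuity makes it Borel and its compositions with real random
variables strongly measurable, as the Banach-valued strong law requires. -/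
theorem continuous_tailFun : Continuous tailFun := by
  refine (LipschitzWith.of_dist_le_mul (K := 1) fun x y => ?_).continuous
  rw [NNReal.coe_one, one_mul, BoundedContinuousFunction.dist_le dist_nonneg]
  intro t
  have := abs_max_sub_max_le_max 0 (x - t) 0 (y - t)
  simpa [tailFun_apply, Real.dist_eq] using this

variable {Ω : Type*} [MeasurableSpace Ω] {P : Measure Ω} [IsProbabilityMeasure P]

theorem integral_tailFun_apply {X : Ω → ℝ} (hX : Integrable X P) (t : ℝ) :
    (∫ ω, tailFun (X ω) ∂P) t = tail P X t - max 0 (-t) := by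
  have hi : Integrable (fun ω => tailFun (X ω)) P :=
    hX.mono (continuous_tailFun.comp_aestronglyMeasurable hX.aestronglyMeasurable)
      (Eventually.of_forall fun ω => norm_tailFun_le _)
  have h := (BoundedContinuousFunction.evalCLM ℝ t).integral_comp_comm hi
  calc (∫ ω, tailFun (X ω) ∂P) t = ∫ ω, (max 0 (X ω - t) - max 0 (-t)) ∂P := h.symm
    _ = _ := by
      rw [integral_sub (integrable_max_zero_sub hX t) (integrable_const _), integral_const,
        probReal_univ, one_smul, tail]

/-- Consistency of the empirical average value-at-risk of an i.i.d. sequence. -/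
theorem ae_tendsto_infTail_empTail {X : ℕ → Ω → ℝ} (hX : Integrable (X 0) P)
    (hindep : Pairwise (Function.onFun (fun U V => IndepFun U V P) X))
    (hid : ∀ i, IdentDistrib (X i) (X 0) P P) {c : ℝ} (hc : 1 ≤ c) :
    ∀ᵐ ω ∂P, Tendsto (fun N => infTail c (empTail (fun i => X i ω) N)) atTop
      (𝓝 (infTail c (tail P (X 0)))) := by
  let _ : MeasurableSpace (ℝ →ᵇ ℝ) := borel _
  have : BorelSpace (ℝ →ᵇ ℝ) := ⟨rfl⟩
  have hm : Measurable tailFun := continuous_tailFun.measurable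
  have hi : Integrable (fun ω => tailFun (X 0 ω)) P :=
    hX.mono (continuous_tailFun.comp_aestronglyMeasurable hX.aestronglyMeasurable)
      (Eventually.of_forall fun ω => norm_tailFun_le _)
  have hslln := strong_law_ae (fun i ω => tailFun (X i ω)) hi
    (fun i j hij => (hindep hij).comp hm hm) fun i => (hid i).comp hm
  filter_upwards [hslln] with ω hω
  rw [tendsto_iff_norm_sub_tendsto_zero] at hω ⊢
  have hω' := hω.const_mul c
  rw [mul_zero] at hω'
  refine squeeze_zero' (Eventually.of_forall fun _ => norm_nonneg _) ?_ hω'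
  filter_upwards [eventually_ne_atTop 0] with N hN
  -- The centering max(0, -t) cancels in the difference, so the sup norm of the centered error
  -- bounds the tail error at every t.
  refine abs_infTail_sub_le (isTail_empTail _ hN) (isTail_tail hX) hc fun t => ?_
  have h1 := BoundedContinuousFunction.norm_coe_le_norm
    ((N : ℝ)⁻¹ • (∑ i ∈ Finset.range N, tailFun (X i ω)) - ∫ ω, tailFun (X 0 ω) ∂P) t
  have hN' : (N : ℝ) ≠ 0 := Nat.cast_ne_zero.2 hN
  have h2 : ((N : ℝ)⁻¹ • (∑ i ∈ Finset.range N, tailFun (X i ω))) t =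
      empTail (fun i => X i ω) N t - max 0 (-t) := by
    simp only [BoundedContinuousFunction.coe_smul, BoundedContinuousFunction.coe_sum,
      Finset.sum_apply, tailFun_apply, Finset.sum_sub_distrib, Finset.sum_const, Finset.card_range,
      nsmul_eq_mul, smul_eq_mul, mul_sub, inv_mul_cancel_left₀ hN', empTail]
  rw [BoundedContinuousFunction.sub_apply, h2, integral_tailFun_apply hX, Real.norm_eq_abs,
    sub_sub_sub_cancel_right] at h1
  exact h1

end LawOfLargeNumbers

/-! ### Lower bounds uniform over compact sets. -/

section UniformLowerBound

variable {Ω : Type*} [MeasurableSpace Ω] {P : Measure Ω} [IsProbabilityMeasure P]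
  {Ξ : Type*} [MeasurableSpace Ξ] {ξ : Ω → Ξ} {ξs : ℕ → Ω → Ξ}

theorem ae_tendsto_infTail_empTail_comp (hξ : Measurable ξ) (hξs : ∀ i, Measurable (ξs i))
    (hindep : iIndepFun ξs P) (hlaw : ∀ i, P.map (ξs i) = P.map ξ) {g : Ξ → ℝ} (hg : Measurable g)
    (hgi : Integrable (fun ω => g (ξ ω)) P) {c : ℝ} (hc : 1 ≤ c) :
    ∀ᵐ ω ∂P, Tendsto (fun N => infTail c (empTail (fun i => g (ξs i ω)) N)) atTop
      (𝓝 (infTail c (tail P fun ω => g (ξ ω)))) := by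
  have hid : ∀ i, IdentDistrib (fun ω => g (ξs i ω)) (fun ω => g (ξ ω)) P P := fun i =>
    IdentDistrib.comp ⟨(hξs i).aemeasurable, hξ.aemeasurable, hlaw i⟩ hg
  have htail : tail P (fun ω => g (ξs 0 ω)) = tail P fun ω => g (ξ ω) := funext fun t =>
    ((hid 0).comp (u := fun r : ℝ => max 0 (r - t)) (by fun_prop)).integral_eq
  rw [← htail]
  exact ae_tendsto_infTail_empTail ((hid 0).integrable_iff.2 hgi)
    (fun i j hij => (hindep.indepFun hij).comp hg hg) (fun i => (hid i).trans (hid 0).symm) hc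

variable {Y : Type*} [PseudoMetricSpace Y] {Y₀ K : Set Y} {f : Y → Ξ → ℝ}

/-- Local uniform lower bound for the empirical average value-at-risk. -/
theorem exists_nhds_ae_eventually_le (hξ : Measurable ξ) (hξs : ∀ i, Measurable (ξs i))
    (hindep : iIndepFun ξs P) (hlaw : ∀ i, P.map (ξs i) = P.map ξ)
    (hf_meas : ∀ y ∈ Y₀, Measurable (f y)) (hf_cont : ∀ x, ContinuousOn (fun y => f y x) Y₀)
    (hK : IsCompact K) (hKY : K ⊆ Y₀) {y₀ : Y} (hy₀ : y₀ ∈ K)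
    (hint : Integrable (fun ω => f y₀ (ξ ω)) P) {U : Set Y} (hU : U ∈ 𝓝 y₀)
    {h : Ω → ℝ} (hh : Integrable h P) (hle : ∀ y ∈ U ∩ Y₀, ∀ᵐ ω ∂P, h ω ≤ f y (ξ ω))
    {c : ℝ} (hc : 1 ≤ c) {η : ℝ} (hη : 0 < η) :
    ∃ V ∈ 𝓝 y₀, ∀ᵐ ω ∂P, ∀ᶠ N in atTop, ∀ y ∈ V ∩ K,
      infTail c (tail P fun ω => f y₀ (ξ ω)) - η ≤ infTail c (empTail (fun i => f y (ξs i ω)) N) := by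
  obtain ⟨D, hDK, hDc, hKD⟩ := hK.isSeparable.exists_countable_dense_subset
  let V : ℕ → Set Y := fun n => interior U ∩ Metric.ball y₀ (1 / ((n : ℝ) + 1))
  have hVo : ∀ n, IsOpen (V n) := fun n => isOpen_interior.inter Metric.isOpen_ball
  have hVy : ∀ n, y₀ ∈ V n := fun n =>
    ⟨mem_interior_iff_mem_nhds.2 hU, Metric.mem_ball_self (by positivity)⟩
  let T : ℕ → Set Y := fun n => V n ∩ D
  have hTcl : ∀ n, ∀ y ∈ V n ∩ K, y ∈ closure (T n) := fun n y hy =>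
    (hVo n).inter_closure ⟨hy.1, hKD hy.2⟩
  have hTY : ∀ n, T n ⊆ Y₀ := fun n y hy => hKY (hDK hy.2)
  have hT0 : ∀ n, T n ⊆ T 0 := fun n y hy => by
    refine ⟨⟨hy.1.1, Metric.ball_subset_ball ?_ hy.1.2⟩, hy.2⟩
    rw [Nat.cast_zero, zero_add]
    exact one_div_le_one_div_of_le one_pos (by simp)
  have hTne : ∀ n, Nonempty (T n) := fun n =>
    (closure_nonempty_iff.1 ⟨y₀, hTcl n y₀ ⟨hVy n, hy₀⟩⟩).to_subtype
  have hTc : ∀ n, Countable (T n) := fun n => (hDc.mono Set.inter_subset_right).to_subtype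
  -- The infimum runs over a countable dense part of the neighbourhood, which keeps it measurable;
  -- continuity of f(·, x) extends the bound to all of `V n ∩ K`.
  let g : ℕ → Ξ → ℝ := fun n x => ⨅ d : T n, f d x
  have hfm : ∀ n, ∀ d : T n, Measurable (f d) := fun n d => hf_meas d (hTY n d.2)
  have hg : ∀ n, Measurable (g n) := fun n => Measurable.iInf (hfm n)
  -- Off `G` a real infimum may be the default 0 and bound nothing. Being measurable, `G` has full
  -- measure under the common law, so almost surely all samples lie in it.
  let G : Set Ξ := {x | BddBelow (Set.range fun d : T 0 => f d x)}
  have hG : MeasurableSet G := measurableSet_bddBelow_range (hfm 0)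
  have hGn : ∀ n, ∀ x ∈ G, BddBelow (Set.range fun d : T n => f d x) := by
    rintro n x ⟨b, hb⟩
    exact ⟨b, by rintro _ ⟨d, rfl⟩; exact hb ⟨⟨d, hT0 n d.2⟩, rfl⟩⟩
  have hhf : ∀ᵐ ω ∂P, ∀ d : T 0, h ω ≤ f d (ξ ω) :=
    ae_all_iff.2 fun d => hle d ⟨interior_subset d.2.1.1, hTY 0 d.2⟩
  have hGξ : ∀ᵐ ω ∂P, ξ ω ∈ G := by
    filter_upwards [hhf] with ω hω
    exact ⟨h ω, by rintro _ ⟨d, rfl⟩; exact hω d⟩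
  have hGξs : ∀ᵐ ω ∂P, ∀ i, ξs i ω ∈ G := by
    refine ae_all_iff.2 fun i => (ae_map_iff (hξs i).aemeasurable hG).1 ?_
    rw [hlaw i]
    exact (ae_map_iff hξ.aemeasurable hG).2 hGξ
  have hgf : ∀ n, ∀ x ∈ G, ∀ y ∈ V n ∩ K, g n x ≤ f y x := fun n x hx y hy =>
    ContinuousWithinAt.closure_le (f := fun _ => g n x) (g := fun y => f y x) (hTcl n y hy)
      continuousWithinAt_const
      ((hf_cont x y (hKY hy.2)).mono (hTY n)) fun d hd => ciInf_le (hGn n x hx) ⟨d, hd⟩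
  have hglim : ∀ x ∈ G, Tendsto (fun n => g n x) atTop (𝓝 (f y₀ x)) := by
    intro x hx
    refine tendsto_order.2 ⟨fun b hb => ?_, fun b hb => Eventually.of_forall fun n =>
      (hgf n x hx y₀ ⟨hVy n, hy₀⟩).trans_lt hb⟩
    obtain ⟨b', hbb', hb'⟩ := exists_between hb
    obtain ⟨δ, hδ, hball⟩ := Metric.mem_nhdsWithin_iff.1
      ((hf_cont x y₀ (hKY hy₀)).eventually (lt_mem_nhds hb'))
    filter_upwards [tendsto_one_div_add_atTop_nhds_zero_nat.eventually (gt_mem_nhds hδ)] with n hn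
    refine hbb'.trans_le (le_ciInf fun d => ?_)
    exact le_of_lt (hball ⟨Metric.ball_subset_ball hn.le d.2.1.2, hTY n d.2⟩)
  have hgabs : ∀ n, ∀ᵐ ω ∂P, |g n (ξ ω)| ≤ |h ω| + |f y₀ (ξ ω)| := by
    intro n
    filter_upwards [hhf, hGξ] with ω h1 h2
    have h3 : h ω ≤ g n (ξ ω) := le_ciInf fun d => h1 ⟨d, hT0 n d.2⟩
    have h4 := hgf n _ h2 y₀ ⟨hVy n, hy₀⟩
    have h5 := neg_abs_le (h ω)
    have h6 := le_abs_self (f y₀ (ξ ω))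
    have h7 := abs_nonneg (h ω)
    have h8 := abs_nonneg (f y₀ (ξ ω))
    rw [abs_le]
    constructor <;> linarith
  have hgi : ∀ n, Integrable (fun ω => g n (ξ ω)) P := fun n =>
    (hh.abs.add hint.abs).mono' ((hg n).comp hξ).aestronglyMeasurable (hgabs n)
  have hDCT : Tendsto (fun n => ∫ ω, |f y₀ (ξ ω) - g n (ξ ω)| ∂P) atTop (𝓝 (∫ _, (0 : ℝ) ∂P)) := by
    refine tendsto_integral_of_dominated_convergence
      (fun ω => |f y₀ (ξ ω)| + (|h ω| + |f y₀ (ξ ω)|))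
      (fun n => (hint.sub (hgi n)).abs.aestronglyMeasurable)
      (hint.abs.add (hh.abs.add hint.abs)) (fun n => ?_) ?_
    · filter_upwards [hgabs n] with ω hω
      rw [Real.norm_eq_abs, abs_abs]
      exact (abs_sub _ _).trans (add_le_add_right hω _)
    · filter_upwards [hGξ] with ω hω
      simpa using ((tendsto_const_nhds (x := f y₀ (ξ ω))).sub (hglim _ hω)).abs
  rw [integral_zero] at hDCT
  have hDCT' := hDCT.const_mul c
  rw [mul_zero] at hDCT'
  -- Half of η pays for replacing f(y₀, ·) by `g n`, the other half for sampling `g n`.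
  obtain ⟨n, hn⟩ := (hDCT'.eventually (gt_mem_nhds (half_pos hη))).exists
  refine ⟨V n, (hVo n).mem_nhds (hVy n), ?_⟩
  filter_upwards [hGξs, ae_tendsto_infTail_empTail_comp hξ hξs hindep hlaw (hg n) (hgi n) hc]
    with ω h1 h2
  filter_upwards [h2.eventually (lt_mem_nhds (sub_lt_self _ (half_pos hη))), eventually_ne_atTop 0]
    with N h3 hN y hy
  have h4 := (abs_le.1 (abs_infTail_tail_sub_le hint (hgi n) hc)).2
  have h5 : infTail c (empTail (fun i => g n (ξs i ω)) N) ≤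
      infTail c (empTail (fun i => f y (ξs i ω)) N) :=
    infTail_mono (isTail_empTail _ hN) hc (empTail_mono (fun i => hgf n _ (h1 i) y hy) N)
  linarith

/-- Uniform lower bound on compact sets for the empirical average value-at-risk. -/
theorem ae_eventually_infTail_le (hξ : Measurable ξ) (hξs : ∀ i, Measurable (ξs i))
    (hindep : iIndepFun ξs P) (hlaw : ∀ i, P.map (ξs i) = P.map ξ)
    (hf_meas : ∀ y ∈ Y₀, Measurable (f y)) (hf_cont : ∀ x, ContinuousOn (fun y => f y x) Y₀)
    (hint : ∀ y ∈ Y₀, Integrable (fun ω => f y (ξ ω)) P)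
    (hf_lower : ∀ y₀ ∈ Y₀, ∃ U ∈ 𝓝 y₀, ∃ h : Ω → ℝ, Integrable h P ∧
      ∀ y ∈ U ∩ Y₀, ∀ᵐ ω ∂P, h ω ≤ f y (ξ ω))
    {c : ℝ} (hc : 1 ≤ c)
    (hA : ContinuousOn (fun y => infTail c (tail P fun ω => f y (ξ ω))) Y₀)
    (hK : IsCompact K) (hKY : K ⊆ Y₀) :
    ∀ᵐ ω ∂P, ∀ η > 0, ∀ᶠ N in atTop, ∀ y ∈ K,
      infTail c (tail P fun ω => f y (ξ ω)) - η ≤ infTail c (empTail (fun i => f y (ξs i ω)) N) := by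
  have key : ∀ η > 0, ∀ᵐ ω ∂P, ∀ᶠ N in atTop, ∀ y ∈ K,
      infTail c (tail P fun ω => f y (ξ ω)) - η ≤
        infTail c (empTail (fun i => f y (ξs i ω)) N) := by
    intro η hη
    refine hK.induction_on (p := fun S => ∀ᵐ ω ∂P, ∀ᶠ N in atTop, ∀ y ∈ S,
      infTail c (tail P fun ω => f y (ξ ω)) - η ≤
        infTail c (empTail (fun i => f y (ξs i ω)) N)) (by simp) ?_ ?_ ?_
    · intro s t hst ht
      filter_upwards [ht] with ω hω
      exact hω.mono fun N hN y hy => hN y (hst hy)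
    · intro s t hs ht
      filter_upwards [hs, ht] with ω h1 h2
      filter_upwards [h1, h2] with N h3 h4 y hy
      exact hy.elim (h3 y) (h4 y)
    · intro y₀ hy₀
      obtain ⟨U, hU, h, hh, hle⟩ := hf_lower y₀ (hKY hy₀)
      obtain ⟨V, hV, hVae⟩ := exists_nhds_ae_eventually_le hξ hξs hindep hlaw hf_meas hf_cont hK
        hKY hy₀ (hint y₀ (hKY hy₀)) hU hh hle hc (half_pos hη)
      have hA' := ((hA y₀ (hKY hy₀)).mono hKY).eventually
        (gt_mem_nhds (lt_add_of_pos_right _ (half_pos hη)))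
      refine ⟨_, inter_mem (inter_mem (mem_nhdsWithin_of_mem_nhds hV) self_mem_nhdsWithin) hA', ?_⟩
      filter_upwards [hVae] with ω hω
      filter_upwards [hω] with N hN y hy
      have h1 := hN y hy.1
      have h2 : infTail c (tail P fun ω => f y (ξ ω)) <
        infTail c (tail P fun ω => f y₀ (ξ ω)) + η / 2 := hy.2
      linarith
  -- The null set depends on η, so only the countably many values 1/(k+1) are used.
  have hseq : ∀ᵐ ω ∂P, ∀ k : ℕ, ∀ᶠ N in atTop, ∀ y ∈ K,
      infTail c (tail P fun ω => f y (ξ ω)) - 1 / ((k : ℝ) + 1) ≤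
        infTail c (empTail (fun i => f y (ξs i ω)) N) :=
    ae_all_iff.2 fun k => key _ (by positivity)
  filter_upwards [hseq] with ω hω η hη
  obtain ⟨k, hk⟩ := exists_nat_one_div_lt hη
  filter_upwards [hω k] with N hN y hy
  linarith [hN y hy]

/-- AVaR is c-Lipschitz for the L¹ norm, which the L² norm dominates on a probability space. -/
theorem continuous_avar {β : ℝ} (hβ0 : 0 ≤ β) (hβ1 : β < 1) :
    Continuous fun X : Lp ℝ 2 P => avar β X := by
  have hc := one_le_one_div_one_sub hβ0 hβ1
  refine (LipschitzWith.of_dist_le_mul (K := (1 / (1 - β)).toNNReal) fun X X' => ?_).continuous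
  rw [Real.coe_toNNReal _ (zero_le_one.trans hc), Real.dist_eq, avar_eq_infTail, avar_eq_infTail]
  refine (abs_infTail_tail_sub_le (integrable_l2 X) (integrable_l2 X') hc).trans
    (mul_le_mul_of_nonneg_left ?_ (zero_le_one.trans hc))
  rw [dist_eq_norm, Lp.norm_def]
  have h1 : ∫ ω, |X ω - X' ω| ∂P = (eLpNorm (X - X' : Lp ℝ 2 P) 1 P).toReal := by
    rw [eLpNorm_one_eq_lintegral_enorm, ← integral_norm_eq_lintegral_enorm
      (Lp.aestronglyMeasurable _)]
    refine integral_congr_ae ?_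
    filter_upwards [Lp.coeFn_sub X X'] with ω hω
    rw [hω, Pi.sub_apply, Real.norm_eq_abs]
  rw [h1]
  exact ENNReal.toReal_mono (Lp.eLpNorm_ne_top _)
    (eLpNorm_le_eLpNorm_of_exponent_le (by norm_num) (Lp.aestronglyMeasurable _))

end UniformLowerBound

end EpiAVaR

end

/-! ### The consistency theorem. -/

/-- Consistency of the epi-regularized empirical approximations of average value-at-risk
optimization problems. -/
theorem mainTheorem5
    {Ω : Type*} [MeasurableSpace Ω] (P : Measure Ω) [IsProbabilityMeasure P] [P.IsComplete]
    (hP : EpiAVaR.Nonatomic P)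
    {Ξ : Type*} [MetricSpace Ξ] [CompleteSpace Ξ] [TopologicalSpace.SeparableSpace Ξ]
    [MeasurableSpace Ξ] [OpensMeasurableSpace Ξ]
    {Z : Type*} [NormedAddCommGroup Z] [NormedSpace ℝ Z] [CompleteSpace Z]
    [TopologicalSpace.SeparableSpace Z] (hZ : EpiAVaR.IsReflexive Z)
    {Y : Type*} [NormedAddCommGroup Y] [NormedSpace ℝ Y] [CompleteSpace Y]
    -- the random element `ξ` and the i.i.d. sample with the same law
    (ξ : Ω → Ξ) (hξ : Measurable ξ)
    (ξs : ℕ → Ω → Ξ) (hξs : ∀ i, Measurable (ξs i))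
    (hindep : iIndepFun ξs P) (hlaw : ∀ i, P.map (ξs i) = P.map ξ)
    -- the feasible sets
    (Zad : Set Z) (hZad_ne : Zad.Nonempty) (hZad_closed : IsClosed Zad)
    (hZad_convex : Convex ℝ Zad) (hZad_bdd : Bornology.IsBounded Zad)
    (Y₀ : Set Y) (hY₀ : IsClosed Y₀)
    -- the linear, completely continuous operator
    (B : Z →ₗ[ℝ] Y) (hB : EpiAVaR.CompletelyContinuous B) (hBmaps : Set.MapsTo B Zad Y₀)
    -- the deterministic cost
    (reg : Z → ℝ) (hreg_nonneg : ∀ z, 0 ≤ reg z) (hreg_convex : ConvexOn ℝ Set.univ reg)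
    (hreg_cont : Continuous reg)
    -- the integrand, of which only the values on `Y₀ × Ξ` matter
    (f : Y → Ξ → ℝ) (hf_meas : ∀ y ∈ Y₀, Measurable (f y))
    (hf_cont : ∀ x, ContinuousOn (fun y => f y x) Y₀)
    (hF_mem : ∀ y ∈ Y₀, MemLp (fun ω => f y (ξ ω)) 2 P)
    (hF_cont : ContinuousOn (fun y => EpiAVaR.toL2 P fun ω => f y (ξ ω)) Y₀)
    (hf_lower : ∀ y₀ ∈ Y₀, ∃ U ∈ 𝓝 y₀, ∃ h : Ω → ℝ, MemLp h 2 P ∧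
      ∀ y ∈ U ∩ Y₀, ∀ᵐ ω ∂P, h ω ≤ f y (ξ ω))
    (β : ℝ) (hβ0 : 0 ≤ β) (hβ1 : β < 1)
    (ε : ℕ → ℝ) (hε_pos : ∀ N, 0 < ε N) (hε_lim : Tendsto ε atTop (𝓝 0)) :
    -- the objective of the true problem
    let J : Z → ℝ := fun z =>
      EpiAVaR.avar β (EpiAVaR.toL2 P fun ω => f (B z) (ξ ω)) + reg z
    -- the objective of the epi-regularized empirical problem with sample size `N`
    let Jepi : ℕ → Ω → Z → ℝ := fun N ω z =>
      EpiAVaR.atDistribution (P := P) (EpiAVaR.epiAvar β (ε N))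
        (EpiAVaR.empiricalCDF (fun i => f (B z) (ξs i ω)) N) + reg z
    (∀ᵐ ω ∂P, Tendsto (fun N => EpiAVaR.optValue Zad (Jepi N ω)) atTop
      (𝓝 (EpiAVaR.optValue Zad J))) ∧
    (EpiAVaR.IsRFunction reg →
      ∀ᵐ ω ∂P, Tendsto
        (fun N => EpiAVaR.deviation (EpiAVaR.solutionSet Zad (Jepi N ω))
          (EpiAVaR.solutionSet Zad J)) atTop (𝓝 0)) := by
  intro J Jepi
  have hc := EpiAVaR.one_le_one_div_one_sub hβ0 hβ1
  let a : Y → ℝ := fun y => EpiAVaR.avar β (EpiAVaR.toL2 P fun ω => f y (ξ ω))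
  have haY : ContinuousOn a Y₀ :=
    (EpiAVaR.continuous_avar hβ0 hβ1).comp_continuousOn hF_cont
  have haA : ∀ y ∈ Y₀, a y =
      EpiAVaR.infTail (1 / (1 - β)) (EpiAVaR.tail P fun ω => f y (ξ ω)) :=
    fun y hy => EpiAVaR.avar_toL2 β (hF_mem y hy)
  have hKY : B '' Zad ⊆ Y₀ := hBmaps.image_subset
  have ha := haY.mono hKY
  have hK := hB.isCompact_image hZ hZad_closed hZad_convex hZad_bdd
  obtain ⟨w, hw, hmin⟩ := EpiAVaR.exists_minimizer hZ hB hZad_ne hZad_closed hZad_convex hZad_bdd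
    ha hreg_nonneg hreg_convex hreg_cont
  have hint : ∀ y ∈ Y₀, Integrable (fun ω => f y (ξ ω)) P := fun y hy =>
    (hF_mem y hy).integrable (by norm_num)
  have herr : ∀ η > 0, ∀ᶠ N in atTop, ∀ x : ℕ → ℝ,
      |EpiAVaR.atDistribution (P := P) (EpiAVaR.epiAvar β (ε N)) (EpiAVaR.empiricalCDF x N) -
        EpiAVaR.infTail (1 / (1 - β)) (EpiAVaR.empTail x N)| ≤ η := by
    intro η hη
    have h1 := hε_lim.const_mul ((1 + 1 / (1 - β)) ^ 2 / 2)
    rw [mul_zero] at h1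
    filter_upwards [h1.eventually (gt_mem_nhds hη), eventually_ne_atTop 0] with N h2 hN x
    exact (EpiAVaR.abs_atDistribution_epiAvar_sub_le hP hβ0 hβ1 (hε_pos N) x hN).trans h2.le
  have hlow : ∀ᵐ ω ∂P, ∀ η > 0, ∀ᶠ N in atTop, ∀ z ∈ Zad, J z - η ≤ Jepi N ω z := by
    have hlow' := EpiAVaR.ae_eventually_infTail_le hξ hξs hindep hlaw hf_meas hf_cont hint
      (fun y hy => by
        obtain ⟨U, hU, h, hh, hle⟩ := hf_lower y hy
        exact ⟨U, hU, h, hh.integrable (by norm_num), hle⟩)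
      hc (haY.congr fun y hy => (haA y hy).symm) hK hKY
    filter_upwards [hlow'] with ω hω η hη
    -- Half of η covers the sampling error, half the regularization error; the latter holds for all
    -- samples at once, so it is uniform in z.
    filter_upwards [hω _ (half_pos hη), herr _ (half_pos hη)] with N h1 h2 z hz
    have h3 := h1 (B z) ⟨z, hz, rfl⟩
    rw [← haA _ (hBmaps hz)] at h3
    have h4 := (abs_le.1 (h2 fun i => f (B z) (ξs i ω))).1
    show a (B z) + reg z - η ≤ _ + reg z
    linarith
  have hup : ∀ᵐ ω ∂P, Tendsto (fun N => Jepi N ω w) atTop (𝓝 (J w)) := by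
    filter_upwards [EpiAVaR.ae_tendsto_infTail_empTail_comp hξ hξs hindep hlaw
      (hf_meas _ (hBmaps hw)) (hint _ (hBmaps hw)) hc] with ω hω
    rw [← haA _ (hBmaps hw)] at hω
    have h1 : Tendsto (fun N => EpiAVaR.atDistribution (P := P) (EpiAVaR.epiAvar β (ε N))
        (EpiAVaR.empiricalCDF (fun i => f (B w) (ξs i ω)) N) - EpiAVaR.infTail (1 / (1 - β))
        (EpiAVaR.empTail (fun i => f (B w) (ξs i ω)) N)) atTop (𝓝 0) := by
      refine Metric.tendsto_nhds.2 fun η hη => ?_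
      filter_upwards [herr _ (half_pos hη)] with N hN
      rw [dist_zero_right]
      exact (hN _).trans_lt (half_lt_self hη)
    simpa using (h1.add hω).add_const (reg w)
  refine ⟨?_, fun hR => ?_⟩
  · filter_upwards [hlow, hup] with ω h1 h2
    exact EpiAVaR.tendsto_optValue hw hmin h1 h2
  · filter_upwards [hlow, hup] with ω h1 h2
    exact EpiAVaR.tendsto_deviation hZ hB hZad_closed hZad_convex hZad_bdd ha hR (fun _ => rfl)
      hw hmin h1 h2
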